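/- Let $X$ be a locally coherent scheme, that is, a scheme such that for every affine open $U\subseteq X$ the ring $\mathcal{O}_X(U)$ is coherent (every finitely generated ideal is finitely presented). A module $A$ over a commutative ring $R$ is called absolutely pure if for every injective $R$-linear map $A\to B$ and every $R$-module $T$ the induced map $T\otimes_R A\to T\otimes_R B$ is injective. Let $\mathscr{F}$ be a quasi-coherent sheaf on $X$. Then the following conditions are equivalent: \begin{enumerate} \item $\mathscr{F}(U)$ is an absolutely pure $\mathcal{O}_X(U)$-module for every affine open $U\subseteq X$; \item there is a cover $\{U_i\}_{i\in I}$ of $X$ by affine open subsets such that $\mathscr{F}(U_i)$ is an absolutely pure $\mathcal{O}_X(U_i)$-module for every $i\in I$; \item $\mathscr{F}_x$ is an absolutely pure $\mathcal{O}_{X,x}$-module for every $x\in X$. \end{enumerate} -/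

import Mathlib

universe u

open CategoryTheory TopologicalSpace AlgebraicGeometry

/-- A commutative ring is coherent if each of its finitely generated ideals is finitely
presented. -/
def IsCoherentRing (R : Type u) [CommRing R] : Prop :=
  ∀ I : Ideal R, I.FG → Module.FinitePresentation R I

/-- An injective `R`-linear map `f : L → M` is pure if `T ⊗ L → T ⊗ M` is injective for every
`R`-module `T`. -/
def IsPureMono {R L M : Type u} [CommRing R] [AddCommGroup L] [Module R L]
    [AddCommGroup M] [Module R M] (f : L →ₗ[R] M) : Prop :=
  Function.Injective f ∧
    ∀ (T : Type u) [AddCommGroup T] [Module R T], Function.Injective (f.lTensor T)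

/-- An `R`-module `A` is absolutely pure if it is pure in every `R`-module containing it. -/
def IsAbsolutelyPure (R A : Type u) [CommRing R] [AddCommGroup A] [Module R A] : Prop :=
  ∀ (B : Type u) [AddCommGroup B] [Module R B] (f : A →ₗ[R] B),
    Function.Injective f → IsPureMono f

/-- A scheme `X` is locally coherent if `𝒪_X(U)` is a coherent ring for each affine open `U`. -/
def IsLocallyCoherent (X : Scheme.{u}) : Prop :=
  ∀ U : X.Opens, IsAffineOpen U → IsCoherentRing Γ(X, U)

/-- The `𝒪_{X,x}`-module structure on the stalk `F_x` of an `𝒪_X`-module `F`: the one Mathlib puts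
on the stalk of a presheaf of modules. -/
noncomputable instance schemeModulesStalkModule {X : Scheme.{u}} (F : X.Modules) (x : X) :
    Module (X.presheaf.stalk x) (F.presheaf.stalk x) :=
  PresheafOfModules.instModuleCarrierStalkCommRingCatCarrierAbPresheafOpensCarrier
    (R := X.presheaf) F.val x

/-- The module structure on the stalk is the one induced by sections: `(r • m)_x = r_x • m_x`. -/
theorem schemeModules_germ_smul {X : Scheme.{u}} (F : X.Modules) (x : X) (U : X.Opens)
    (hx : x ∈ U) (r : Γ(X, U)) (m : Γ(F, U)) :
    F.presheaf.germ U x hx (r • m) = X.presheaf.germ U x hx r • F.presheaf.germ U x hx m :=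
  PresheafOfModules.germ_smul (R := X.presheaf) F.val x U hx r m

/-! Absolute purity is equivalent to an equational condition: a finite linear system over `A` is
solvable as soon as every relation between its rows is respected by its constants. In this form both
directions between sections and stalks are elementary. Over a coherent ring the row relations are
finitely generated, so one denominator makes a localized system compatible again; hence the
condition localizes (`SolvesCompatibleSystems.localization`). Conversely, the `r` for which `r • a`
is solvable form an ideal, so solvability is tested at maximal ideals
(`solvesCompatibleSystems_of_forall_isMaximal`). Quasi-coherence makes the stalk at a point of an
affine open a localization of the sections (`isLocalizedModule_germLinearMap`), which gives 2 → 3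
and 3 → 1. -/

/-- An `R`-module `A` solves compatible systems if each finite system of linear equations
`∑ k, c j k • x k = a j` over `A` has a solution, provided that each linear relation between the
rows of `c` also holds between the entries of `a`. -/
def SolvesCompatibleSystems (R A : Type*) [CommRing R] [AddCommGroup A] [Module R A] : Prop :=
  ∀ (m n : ℕ) (c : Fin m → Fin n → R) (a : Fin m → A),
    (∀ l : Fin m → R, ∑ j, l j • c j = 0 → ∑ j, l j • a j = 0) →
      ∃ x : Fin n → A, ∀ j, a j = ∑ k, c j k • x k

/-! ### Absolute purity as solvability of linear systems. -/

section AbsolutelyPure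

open scoped TensorProduct

variable {R : Type u} [CommRing R]

/-- A finite linear system with constants in `L` that has a solution in a pure extension of `L`
has a solution in `L`. -/
theorem IsPureMono.exists_solution {L M : Type u} [AddCommGroup L] [Module R L] [AddCommGroup M]
    [Module R M] {f : L →ₗ[R] M} (hf : IsPureMono f) {m n : ℕ} (c : Fin m → Fin n → R)
    (a : Fin m → L) (y : Fin n → M) (hy : ∀ j, f (a j) = ∑ k, c j k • y k) :
    ∃ x : Fin n → L, ∀ j, a j = ∑ k, c j k • x k := by
  -- Purity is tested on the quotient of `R^m` by the columns of `c`: there `∑ j, c j k • e j = 0`,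
  -- so the solution `y` makes `∑ e j ⊗ f (a j)` vanish.
  let N : Submodule R (Fin m → R) := Submodule.span R (Set.range fun k j ↦ c j k)
  let e : Fin m → (Fin m → R) ⧸ N := fun j ↦ N.mkQ (Pi.single j 1)
  have he (v : Fin m → R) : ∑ j, v j • e j = N.mkQ v := by
    simp only [e, ← map_smul, ← map_sum]
    congr 1
    exact (pi_eq_sum_univ' v).symm
  have hspan : Submodule.span R (Set.range e) = ⊤ := by
    rw [eq_top_iff]
    rintro q -
    obtain ⟨v, rfl⟩ := N.mkQ_surjective q
    rw [← he]
    exact sum_mem fun j _ ↦ Submodule.smul_mem _ _ (Submodule.subset_span ⟨j, rfl⟩)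
  have hzero : ∑ j, e j ⊗ₜ[R] a j = 0 := by
    apply hf.2
    rw [map_sum, map_zero]
    simp only [LinearMap.lTensor_tmul]
    apply TensorProduct.sum_tmul_eq_zero_of_vanishesTrivially
    refine ⟨n, c, y, hy, fun k ↦ ?_⟩
    rw [he fun j ↦ c j k]
    exact (Submodule.Quotient.mk_eq_zero _).2 (Submodule.subset_span ⟨k, rfl⟩)
  obtain ⟨p, b, z, hz, hb⟩ := TensorProduct.vanishesTrivially_of_sum_tmul_eq_zero R hspan hzero
  have hmem (i : Fin p) : (fun j ↦ b j i) ∈ N := by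
    rw [← Submodule.Quotient.mk_eq_zero, ← hb i, he fun j ↦ b j i]
    rfl
  have hd (i : Fin p) : ∃ d : Fin n → R, ∑ k, d k • (fun j ↦ c j k) = fun j ↦ b j i :=
    (Submodule.mem_span_range_iff_exists_fun R).1 (hmem i)
  choose d hd using hd
  refine ⟨fun k ↦ ∑ i, d i k • z i, fun j ↦ ?_⟩
  have hbd (i : Fin p) : b j i = ∑ k, d i k * c j k := by
    have := congrFun (hd i) j
    simpa [Finset.sum_apply] using this.symm
  rw [hz]
  simp only [hbd, Finset.sum_smul, Finset.smul_sum, smul_smul]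
  rw [Finset.sum_comm]
  simp only [mul_comm]

theorem TensorProduct.exists_sum_tmul_eq_of_span_eq_top {T A ι : Type*} [AddCommGroup T]
    [Module R T] [AddCommGroup A] [Module R A] [Fintype ι] {t : ι → T}
    (ht : Submodule.span R (Set.range t) = ⊤) (x : T ⊗[R] A) :
    ∃ a : ι → A, x = ∑ j, t j ⊗ₜ[R] a j := by
  induction x with
  | zero => exact ⟨0, by simp⟩
  | tmul s y =>
    obtain ⟨c, rfl⟩ := (Submodule.mem_span_range_iff_exists_fun R).1
      (ht ▸ Submodule.mem_top : s ∈ Submodule.span R (Set.range t))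
    exact ⟨fun j ↦ c j • y, by simp [TensorProduct.sum_tmul, TensorProduct.smul_tmul]⟩
  | add x y hx hy =>
    obtain ⟨a, rfl⟩ := hx
    obtain ⟨b, rfl⟩ := hy
    exact ⟨a + b, by simp [TensorProduct.tmul_add, Finset.sum_add_distrib]⟩

theorem SolvesCompatibleSystems.lTensor_injective_of_finite {T A B : Type*} [AddCommGroup A]
    [Module R A] [AddCommGroup B] [Module R B] [AddCommGroup T] [Module R T] [Module.Finite R T]
    (hA : SolvesCompatibleSystems R A) {f : A →ₗ[R] B} (hf : Function.Injective f) :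
    Function.Injective (f.lTensor T) := by
  rw [injective_iff_map_eq_zero]
  intro x hx
  obtain ⟨m, t, ht⟩ := Module.Finite.exists_fin (R := R) (M := T)
  obtain ⟨a, rfl⟩ := TensorProduct.exists_sum_tmul_eq_of_span_eq_top ht x
  simp only [map_sum, LinearMap.lTensor_tmul] at hx
  obtain ⟨n, c, y, hy, hc⟩ := TensorProduct.vanishesTrivially_of_sum_tmul_eq_zero R ht hx
  -- The system is compatible because `y` solves it in `B` and `f` is injective.
  obtain ⟨x, hx⟩ := hA m n c a fun l hl ↦ hf <| by
    have hl' (k : Fin n) : ∑ j, l j * c j k = 0 := by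
      simpa [Finset.sum_apply] using congrFun hl k
    simp only [map_sum, map_smul, hy, Finset.smul_sum, smul_smul, map_zero]
    rw [Finset.sum_comm]
    simp [← Finset.sum_smul, hl']
  exact TensorProduct.sum_tmul_eq_zero_of_vanishesTrivially R ⟨n, c, x, hx, hc⟩

/-- An element of the tensor product, and the reason its image vanishes, both live over finitely
generated submodules of `T`. -/
theorem SolvesCompatibleSystems.lTensor_injective {T A B : Type*} [AddCommGroup A]
    [Module R A] [AddCommGroup B] [Module R B] [AddCommGroup T] [Module R T]
    (hA : SolvesCompatibleSystems R A) {f : A →ₗ[R] B} (hf : Function.Injective f) :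
    Function.Injective (f.lTensor T) := by
  rw [injective_iff_map_eq_zero]
  intro x hx
  obtain ⟨P, hP, v, rfl⟩ := TensorProduct.exists_of_fg x
  obtain ⟨Q, hPQ, hQ, h⟩ := TensorProduct.eq_zero_of_fg_of_subtype_eq_zero hP
    (t := f.lTensor P v) (by
      rw [← hx, ← LinearMap.comp_apply, ← LinearMap.comp_apply, LinearMap.rTensor_comp_lTensor,
        LinearMap.lTensor_comp_rTensor])
  have : Module.Finite R Q := Module.Finite.of_fg hQ
  have hzero : (Submodule.inclusion hPQ).rTensor A v = 0 := by
    apply hA.lTensor_injective_of_finite hf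
    rw [map_zero, ← h, ← LinearMap.comp_apply, ← LinearMap.comp_apply,
      LinearMap.rTensor_comp_lTensor, LinearMap.lTensor_comp_rTensor]
  rw [← Submodule.subtype_comp_inclusion P Q hPQ, LinearMap.rTensor_comp, LinearMap.comp_apply,
    hzero, map_zero]

theorem isAbsolutelyPure_iff_solvesCompatibleSystems {A : Type u} [AddCommGroup A] [Module R A] :
    IsAbsolutelyPure R A ↔ SolvesCompatibleSystems R A := by
  refine ⟨fun h m n c a hca ↦ ?_, fun h B _ _ f hf ↦ ⟨hf, fun T _ _ ↦ h.lTensor_injective hf⟩⟩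
  -- The quotient by `K` freely adjoins a solution to `A`; compatibility says exactly that `A` still
  -- embeds.
  let K : Submodule R (A × (Fin n → R)) := Submodule.span R (Set.range fun j ↦ (a j, -c j))
  let f : A →ₗ[R] (A × (Fin n → R)) ⧸ K := K.mkQ ∘ₗ LinearMap.inl R A (Fin n → R)
  have hf : Function.Injective f := by
    rw [injective_iff_map_eq_zero]
    intro y hy
    obtain ⟨l, hl⟩ := (Submodule.mem_span_range_iff_exists_fun R).1
      ((Submodule.Quotient.mk_eq_zero K).1 hy)
    have h₁ : ∑ j, l j • a j = y := by simpa [Prod.fst_sum] using congrArg Prod.fst hl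
    have h₂ : ∑ j, l j • c j = 0 := by simpa [Prod.snd_sum] using congrArg Prod.snd hl
    rw [← h₁, hca l h₂]
  refine (h _ f hf).exists_solution c a (fun k ↦ K.mkQ (0, Pi.single k 1)) fun j ↦ ?_
  have hsum : ∑ k, c j k • K.mkQ (0, Pi.single k 1) = K.mkQ (0, c j) := by
    simp only [← map_smul, ← map_sum]
    congr 1
    refine Prod.ext (by simp [Prod.fst_sum]) ?_
    simpa [Prod.snd_sum] using (pi_eq_sum_univ' (c j)).symm
  rw [hsum]
  refine (Submodule.Quotient.eq K).2 (Submodule.subset_span ⟨j, ?_⟩)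
  simp

end AbsolutelyPure

/-! ### Finite generation of relations over a coherent ring. -/

section Coherent

variable {R : Type u} [CommRing R]

theorem IsCoherentRing.fg_ker_of_finite (hR : IsCoherentRing R) {M : Type*} [AddCommGroup M]
    [Module R M] [Module.Finite R M] (f : M →ₗ[R] R) : (LinearMap.ker f).FG := by
  have hfg : (LinearMap.range f).FG := by
    rw [LinearMap.range_eq_map]
    exact Module.Finite.fg_top.map f
  have := hR _ hfg
  rw [← LinearMap.ker_rangeRestrict]
  exact Module.FinitePresentation.fg_ker _ f.surjective_rangeRestrict

/-- Over a coherent ring, the solutions of finitely many homogeneous linear equations form a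
finitely generated module. -/
theorem IsCoherentRing.fg_ker_pi (hR : IsCoherentRing R) {M : Type*} [AddCommGroup M]
    [Module R M] [Module.Finite R M] : ∀ (n : ℕ) (f : M →ₗ[R] (Fin n → R)), (LinearMap.ker f).FG
  | 0, f => by
    rw [show LinearMap.ker f = ⊤ from eq_top_iff.2 fun x _ ↦ Subsingleton.elim _ _]
    exact Module.Finite.fg_top
  | n + 1, f => by
    let g : M →ₗ[R] (Fin n → R) := LinearMap.pi fun i ↦ LinearMap.proj i.castSucc ∘ₗ f
    let h : M →ₗ[R] R := LinearMap.proj (Fin.last n) ∘ₗ f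
    have : Module.Finite R (LinearMap.ker g) := Module.Finite.of_fg (hR.fg_ker_pi n g)
    have hker : LinearMap.ker f =
        (LinearMap.ker (h ∘ₗ (LinearMap.ker g).subtype)).map (LinearMap.ker g).subtype := by
      ext x
      simp only [LinearMap.mem_ker, Submodule.mem_map, LinearMap.comp_apply,
        Submodule.subtype_apply, Subtype.exists, exists_and_right, exists_eq_right]
      simp [g, h, funext_iff, Fin.forall_fin_succ', and_comm]
    rw [hker]
    exact (hR.fg_ker_of_finite _).map _

end Coherent

/-! ### Compatible systems under localization, and the local-global principle. -/

section Localization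

variable {R R' : Type u} [CommRing R] [CommRing R'] [Algebra R R'] (S : Submonoid R)
  [IsLocalization S R'] {A A' : Type*} [AddCommGroup A] [Module R A] [AddCommGroup A']
  [Module R A'] [Module R' A'] [IsScalarTower R R' A'] (g : A →ₗ[R] A') [IsLocalizedModule S g]

include S g in
/-- Over a coherent ring, solvability of compatible systems passes to localizations. -/
theorem SolvesCompatibleSystems.localization (hR : IsCoherentRing R)
    (hA : SolvesCompatibleSystems R A) : SolvesCompatibleSystems R' A' := by
  intro m n c' a' hca'
  obtain ⟨s, hs⟩ := IsLocalization.exist_integer_multiples_of_finite S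
    fun p : Fin m × Fin n ↦ c' p.1 p.2
  choose c hc using fun j k ↦ hs (j, k)
  replace hc (j k) : algebraMap R R' (c j k) = algebraMap R R' s * c' j k := by
    rw [hc, Algebra.smul_def]
  obtain ⟨v, hv⟩ := IsLocalizedModule.exist_integer_multiples_of_finite S g a'
  choose a ha using hv
  have hsyz (l : Fin m → R) (hl : ∑ j, l j • c j = 0) : g (∑ j, l j • a j) = 0 := by
    have h₁ : ∑ j, algebraMap R R' (l j) • c' j = 0 := by
      ext k
      apply (IsLocalization.map_units R' s).mul_left_cancel
      have := congrArg (algebraMap R R') (congrFun hl k)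
      simp only [Finset.sum_apply, Pi.smul_apply, smul_eq_mul, map_sum, map_mul, hc,
        Pi.zero_apply, map_zero] at this
      simp only [Finset.sum_apply, Pi.smul_apply, smul_eq_mul, Pi.zero_apply, mul_zero,
        Finset.mul_sum]
      rw [← this]
      exact Finset.sum_congr rfl fun j _ ↦ by ring
    have h₂ := hca' _ h₁
    simp only [algebraMap_smul] at h₂
    simp only [map_sum, map_smul, ha, smul_comm _ (v : R), ← Finset.smul_sum, h₂, smul_zero]
  -- The kernel of `f` consists of the row relations. It is finitely generated by coherence, so a
  -- single `t` in `S` kills all the defects `∑ j, l j • a j`.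
  let f := Fintype.linearCombination R c
  have : Module.Finite R (LinearMap.ker f) := Module.Finite.of_fg (hR.fg_ker_pi n f)
  obtain ⟨t, ht⟩ := Module.Finite.exists_smul_of_comp_eq_of_isLocalizedModule S g
    (Fintype.linearCombination R a ∘ₗ (LinearMap.ker f).subtype) 0 <| by
      ext ⟨l, hl⟩
      simpa [Fintype.linearCombination_apply] using
        hsyz l (by simpa [f, Fintype.linearCombination_apply] using hl)
  obtain ⟨x, hx⟩ := hA m n c (fun j ↦ (t : R) • a j) fun l hl ↦ by
    have := LinearMap.congr_fun ht
      ⟨l, show f l = 0 by simpa [f, Fintype.linearCombination_apply] using hl⟩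
    simp only [smul_comm _ (t : R), ← Finset.smul_sum]
    simpa [Fintype.linearCombination_apply, Submonoid.smul_def] using this
  -- Here `c = s c'` and `g a = v a'`, while `x` solves the system with constants `t a`; hence the
  -- factor `s / (t v)`.
  refine ⟨fun k ↦ IsLocalization.mk' R' (s : R) (t * v) • g (x k), fun j ↦ ?_⟩
  have hunit : IsUnit (algebraMap R R' (t * v : S)) := IsLocalization.map_units R' (t * v)
  rw [← hunit.smul_left_cancel]
  have h₁ := congrArg g (hx j)
  simp only [map_smul, ha, map_sum] at h₁
  rw [algebraMap_smul, Submonoid.coe_mul, mul_smul, h₁, Finset.smul_sum]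
  refine Finset.sum_congr rfl fun k _ ↦ ?_
  rw [smul_comm (algebraMap R R' _), smul_smul (algebraMap R R' _), ← Submonoid.coe_mul,
    IsLocalization.mk'_spec', smul_smul, mul_comm, ← hc, algebraMap_smul]


include S g in
/-- A compatible system that becomes solvable after localization at `S` is solvable up to a
denominator in `S`. -/
theorem SolvesCompatibleSystems.exists_smul_solution (h : SolvesCompatibleSystems R' A') {m n : ℕ}
    (c : Fin m → Fin n → R) (a : Fin m → A)
    (hca : ∀ l : Fin m → R, ∑ j, l j • c j = 0 → ∑ j, l j • a j = 0) :
    ∃ r ∈ S, ∃ x : Fin n → A, ∀ j, r • a j = ∑ k, c j k • x k := by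
  obtain ⟨x', hx'⟩ := h m n (fun j k ↦ algebraMap R R' (c j k)) (fun j ↦ g (a j)) <| by
    intro l' hl'
    obtain ⟨s, hs⟩ := IsLocalization.exist_integer_multiples_of_finite S l'
    choose l hl using hs
    have hzero (k : Fin n) : algebraMap R R' (∑ j, l j * c j k) = algebraMap R R' 0 := by
      have := congrFun hl' k
      simp only [Finset.sum_apply, Pi.smul_apply, smul_eq_mul, Pi.zero_apply] at this
      simp only [map_sum, map_mul, hl, smul_mul_assoc, ← Finset.smul_sum, this, smul_zero, map_zero]
    choose t ht using fun k ↦ (IsLocalization.eq_iff_exists S R').1 (hzero k)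
    -- Multiplying by `w` turns the relation, so far valid only after localization, into one over
    -- `R`.
    let w := ∏ k, t k
    have hw (k : Fin n) : (w : R) * ∑ j, l j * c j k = 0 := by
      obtain ⟨q, hq⟩ := Finset.dvd_prod_of_mem t (Finset.mem_univ k)
      rw [show w = t k * q from hq, mul_comm (t k), Submonoid.coe_mul, mul_assoc, ht, mul_zero,
        mul_zero]
    have hrel : ∑ j, (w * l j : R) • a j = 0 := hca _ <| by
      ext k
      rw [Pi.zero_apply, ← hw k]
      simp [Finset.sum_apply, Finset.mul_sum, mul_assoc]
    have hunit : IsUnit (algebraMap R R' (w * s : S)) :=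
      IsLocalization.map_units R' (w * s)
    rw [← hunit.smul_left_cancel, smul_zero, ← map_zero g, ← hrel]
    simp only [map_sum, map_smul, Finset.smul_sum]
    refine Finset.sum_congr rfl fun j _ ↦ ?_
    rw [mul_smul, ← algebraMap_smul R' (l j), hl, algebraMap_smul, Submonoid.coe_mul,
      mul_smul, smul_assoc]
  obtain ⟨s, hs⟩ := IsLocalizedModule.exist_integer_multiples_of_finite S g x'
  choose x hx using hs
  have heq (j : Fin m) : g ((s : R) • a j) = g (∑ k, c j k • x k) := by
    simp only [map_smul, map_sum, hx', hx, Finset.smul_sum, algebraMap_smul]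
    exact Finset.sum_congr rfl fun k _ ↦ smul_comm _ _ _
  choose t ht using fun j ↦ (IsLocalizedModule.eq_iff_exists S g).1 (heq j)
  let w := ∏ j, t j
  refine ⟨w * s, (w * s).2, fun k ↦ (w : R) • x k, fun j ↦ ?_⟩
  obtain ⟨q, hq⟩ := Finset.dvd_prod_of_mem t (Finset.mem_univ j)
  have := ht j
  rw [Submonoid.smul_def, Submonoid.smul_def] at this
  simp only [smul_comm _ (w : R), ← Finset.smul_sum]
  rw [mul_smul, show w = t j * q from hq, mul_comm (t j), Submonoid.coe_mul, mul_smul, mul_smul,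
    this]

end Localization

theorem solvesCompatibleSystems_of_forall_isMaximal {R A : Type*} [CommRing R]
    [AddCommGroup A] [Module R A]
    (h : ∀ (m n : ℕ) (c : Fin m → Fin n → R) (a : Fin m → A),
      (∀ l : Fin m → R, ∑ j, l j • c j = 0 → ∑ j, l j • a j = 0) →
        ∀ P : Ideal R, P.IsMaximal →
          ∃ r ∉ P, ∃ x : Fin n → A, ∀ j, r • a j = ∑ k, c j k • x k) :
    SolvesCompatibleSystems R A := by
  intro m n c a hca
  let f : (Fin n → A) →ₗ[R] (Fin m → A) :=
    LinearMap.pi fun j ↦ ∑ k, c j k • LinearMap.proj k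
  have hf (x j) : f x j = ∑ k, c j k • x k := by simp [f]
  -- This colon ideal collects the `r` with `r • a` solvable; by hypothesis no maximal ideal
  -- contains it.
  suffices hJ : (LinearMap.range f).colon {a} = ⊤ by
    obtain ⟨x, hx⟩ : a ∈ LinearMap.range f := by
      simpa [Submodule.mem_colon_singleton] using (Ideal.eq_top_iff_one _).1 hJ
    exact ⟨x, fun j ↦ by rw [← hf, hx]⟩
  by_contra hne
  obtain ⟨P, hP, hJP⟩ := Ideal.exists_le_maximal _ hne
  obtain ⟨r, hr, x, hx⟩ := h m n c a hca P hP
  refine hr (hJP (Submodule.mem_colon_singleton.2 ⟨x, ?_⟩))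
  ext j
  rw [hf, Pi.smul_apply, hx]

/-! ### Stalks of quasi-coherent modules as localizations. -/

namespace AlgebraicGeometry

variable {X : Scheme.{u}} {U : X.Opens}

theorem IsAffineOpen.appIso_fromSpec_inv_ΓSpecIso_inv (hU : IsAffineOpen U)
    (W : (Spec Γ(X, U)).Opens) (hW : hU.fromSpec ''ᵁ W ≤ U) (r : Γ(X, U)) :
    (hU.fromSpec.appIso W).inv ((Spec Γ(X, U)).presheaf.map W.leTop.op
      ((Scheme.ΓSpecIso Γ(X, U)).inv r)) = X.presheaf.map (homOfLE hW).op r := by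
  have : (Scheme.ΓSpecIso Γ(X, U)).inv ≫ (Spec Γ(X, U)).presheaf.map W.leTop.op ≫
      (hU.fromSpec.appIso W).inv = X.presheaf.map (homOfLE hW).op := by
    rw [← Category.assoc, Iso.comp_inv_eq, Scheme.Hom.appIso_hom', Scheme.Hom.map_appLE,
      Scheme.Hom.appLE, hU.fromSpec_app_self, Category.assoc, ← Functor.map_comp]
    rfl
  simp only [← this, CommRingCat.comp_apply]

namespace Scheme.Modules

variable (F : X.Modules)

theorem smul_restrict_fromSpec (hU : IsAffineOpen U) (W : (Spec Γ(X, U)).Opens)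
    (hW : hU.fromSpec ''ᵁ W ≤ U) (r : Γ(X, U)) (s : Γ(F.restrict hU.fromSpec, W)) :
    (F.restrictAppIso hU.fromSpec W).hom (r • s) =
      X.presheaf.map (homOfLE hW).op r • (F.restrictAppIso hU.fromSpec W).hom s := by
  rw [← hU.appIso_fromSpec_inv_ΓSpecIso_inv W hW r, smul_Spec_def]
  exact smul_restrictAppIso_hom_apply _ _ _ _ _

/-- The action of sections over `U` on the stalk at a point of `U`. -/
noncomputable instance sectionStalkModule (x : U) : Module Γ(X, U) (F.presheaf.stalk (x : X)) :=
  Module.compHom _ (algebraMap Γ(X, U) (X.presheaf.stalk (x : X)))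

instance (x : U) :
    IsScalarTower Γ(X, U) (X.presheaf.stalk (x : X)) (F.presheaf.stalk (x : X)) :=
  .of_algebraMap_smul fun _ _ ↦ rfl

/-- The germ at a point of `U`, as a linear map over the sections of the structure sheaf on `U`. -/
noncomputable def germLinearMap (x : U) : Γ(F, U) →ₗ[Γ(X, U)] F.presheaf.stalk (x : X) where
  toFun := F.presheaf.germ U x x.2
  map_add' := map_add _
  map_smul' r m := schemeModules_germ_smul F x U x.2 r m

variable [F.IsQuasicoherent]

/-- Pulled back along `hU.fromSpec`, quasi-coherence says that restriction to a basic open localizes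
at the powers of `f`. This is the surjectivity half; the next lemma describes the kernel. -/
theorem exists_map_basicOpen_eq_pow_smul (hU : IsAffineOpen U) (f : Γ(X, U))
    (s : Γ(F, X.basicOpen f)) : ∃ (n : ℕ) (t : Γ(F, U)),
      F.presheaf.map (homOfLE (X.basicOpen_le f)).op t =
        X.presheaf.map (homOfLE (X.basicOpen_le f)).op f ^ n • s := by
  have hloc := (isIso_fromTildeΓ_iff_isLocalizing (F.restrict hU.fromSpec)).1 inferInstance f
  have htop : U ≤ hU.fromSpec ''ᵁ ⊤ := by simp
  let W : (Spec Γ(X, U)).Opens := PrimeSpectrum.basicOpen f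
  have hle : hU.fromSpec ''ᵁ W ≤ X.basicOpen f :=
    (hU.fromSpec_image_basicOpen f).le
  have hge : X.basicOpen f ≤ hU.fromSpec ''ᵁ W :=
    (hU.fromSpec_image_basicOpen f).ge
  let s' : Γ(F.restrict hU.fromSpec, W) :=
    (F.restrictAppIso hU.fromSpec W).inv (F.presheaf.map (homOfLE hle).op s)
  obtain ⟨⟨t', ⟨_, n, rfl⟩⟩, ht'⟩ := hloc.surj s'
  have ht : (F.restrictAppIso hU.fromSpec W).hom (f ^ n • s') =
      F.presheaf.map (homOfLE (Scheme.Hom.image_mono _ le_top)).op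
        ((F.restrictAppIso hU.fromSpec ⊤).hom t') :=
    congrArg (F.restrictAppIso hU.fromSpec W).hom ht'
  rw [F.smul_restrict_fromSpec hU _ (hle.trans (X.basicOpen_le f))] at ht
  refine ⟨n, F.presheaf.map (homOfLE htop).op ((F.restrictAppIso hU.fromSpec ⊤).hom t'), ?_⟩
  have h := congrArg (F.presheaf.map (homOfLE hge).op) ht
  rw [map_smul] at h
  simp only [s', Iso.inv_hom_id_apply, ← Functor.map_comp_apply, ← op_comp, homOfLE_comp] at h ⊢
  rw [← h, map_pow]
  congr 1
  simp

theorem exists_pow_smul_eq_zero_of_map_basicOpen_eq_zero (hU : IsAffineOpen U) (f : Γ(X, U))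
    (t : Γ(F, U)) (ht : F.presheaf.map (homOfLE (X.basicOpen_le f)).op t = 0) :
    ∃ n : ℕ, f ^ n • t = 0 := by
  have hloc := (isIso_fromTildeΓ_iff_isLocalizing (F.restrict hU.fromSpec)).1 inferInstance f
  have htop : U ≤ hU.fromSpec ''ᵁ ⊤ := by simp
  have htop' : hU.fromSpec ''ᵁ ⊤ ≤ U := by simp
  have hle : hU.fromSpec ''ᵁ PrimeSpectrum.basicOpen f ≤ X.basicOpen f :=
    (hU.fromSpec_image_basicOpen f).le
  let t' : Γ(F.restrict hU.fromSpec, ⊤) :=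
    (F.restrictAppIso hU.fromSpec _).inv (F.presheaf.map (homOfLE htop').op t)
  have hres : F.presheaf.map (homOfLE (hle.trans (X.basicOpen_le f))).op t = 0 := by
    rw [← homOfLE_comp hle (X.basicOpen_le f), op_comp, Functor.map_comp_apply, ht, map_zero]
  have hzero : ((modulesSpecToSheaf.obj (F.restrict hU.fromSpec)).obj.map
      (PrimeSpectrum.basicOpen f).leTop.op).hom t' = 0 := by
    refine Eq.trans ?_ hres
    exact (Functor.map_comp_apply F.presheaf (homOfLE htop').op
      (homOfLE (Scheme.Hom.image_mono _ le_top)).op t).symm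
  obtain ⟨⟨_, n, rfl⟩, hn⟩ := (IsLocalizedModule.eq_zero_iff (.powers f) _).1 hzero
  refine ⟨n, ?_⟩
  have h : (F.restrictAppIso hU.fromSpec ⊤).hom (f ^ n • t') = 0 :=
    (congrArg (F.restrictAppIso hU.fromSpec ⊤).hom hn).trans (map_zero _)
  rw [F.smul_restrict_fromSpec hU _ htop'] at h
  have h' := congrArg (F.presheaf.map (homOfLE htop).op) h
  rw [map_smul, map_zero] at h'
  simp only [t', Iso.inv_hom_id_apply, ← Functor.map_comp_apply, ← op_comp, homOfLE_comp] at h'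
  simpa using h'

/-- The stalk of a quasi-coherent module at a point of an affine open `U` is the localization of
the module of sections over `U`. -/
theorem isLocalizedModule_germLinearMap (hU : IsAffineOpen U) (x : U) :
    IsLocalizedModule (hU.primeIdealOf x).asIdeal.primeCompl (F.germLinearMap x) := by
  have hloc := hU.isLocalization_stalk x
  have hmem {f : Γ(X, U)} (hf : (x : X) ∈ X.basicOpen f) :
      f ∈ (hU.primeIdealOf x).asIdeal.primeCompl :=
    (IsLocalization.AtPrime.isUnit_to_map_iff (X.presheaf.stalk (x : X)) _ f).1
      ((X.mem_basicOpen f x x.2).1 hf)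
  refine ⟨fun r ↦ ?_, fun y ↦ ?_, fun {t₁ t₂} h ↦ ?_⟩
  · have hr : IsUnit (algebraMap Γ(X, U) (X.presheaf.stalk (x : X)) r) :=
      IsLocalization.map_units _ r
    rw [Module.End.isUnit_iff]
    have := (Module.End.isUnit_iff _).1
      (hr.map (algebraMap _ (Module.End (X.presheaf.stalk (x : X)) (F.presheaf.stalk (x : X)))))
    exact this
  · obtain ⟨V, hxV, s, rfl⟩ := F.presheaf.exists_germ_eq y
    obtain ⟨f, hfV, hxf⟩ := hU.exists_basicOpen_le ⟨(x : X), hxV⟩ x.2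
    obtain ⟨n, t, ht⟩ := F.exists_map_basicOpen_eq_pow_smul hU f (F.presheaf.map (homOfLE hfV).op s)
    refine ⟨(t, ⟨f ^ n, pow_mem (hmem hxf) n⟩), ?_⟩
    have h := congrArg (F.presheaf.germ _ (x : X) hxf) ht
    rw [schemeModules_germ_smul, map_pow, TopCat.Presheaf.germ_res_apply,
      TopCat.Presheaf.germ_res_apply, TopCat.Presheaf.germ_res_apply, ← map_pow] at h
    exact h.symm
  · obtain ⟨W, hxW, i, j, hW⟩ := F.presheaf.germ_eq (x : X) x.2 x.2 t₁ t₂ h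
    obtain ⟨f, hfW, hxf⟩ := hU.exists_basicOpen_le ⟨(x : X), hxW⟩ x.2
    obtain ⟨n, hn⟩ := F.exists_pow_smul_eq_zero_of_map_basicOpen_eq_zero hU f (t₁ - t₂) <| by
      rw [map_sub, sub_eq_zero]
      have := congrArg (F.presheaf.map (homOfLE hfW).op) hW
      rw [← Functor.map_comp_apply, ← Functor.map_comp_apply] at this
      exact this
    refine ⟨⟨f ^ n, pow_mem (hmem hxf) n⟩, ?_⟩
    rw [smul_sub, sub_eq_zero] at hn
    exact hn

theorem solvesCompatibleSystems_stalk (hU : IsAffineOpen U) (hR : IsCoherentRing Γ(X, U))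
    (h : SolvesCompatibleSystems Γ(X, U) Γ(F, U)) (x : U) :
    SolvesCompatibleSystems (X.presheaf.stalk (x : X)) (F.presheaf.stalk (x : X)) := by
  have := hU.isLocalization_stalk x
  have := F.isLocalizedModule_germLinearMap hU x
  exact h.localization (hU.primeIdealOf x).asIdeal.primeCompl (F.germLinearMap x) hR

theorem solvesCompatibleSystems_of_stalk (hU : IsAffineOpen U)
    (h : ∀ x : U, SolvesCompatibleSystems (X.presheaf.stalk (x : X)) (F.presheaf.stalk (x : X))) :
    SolvesCompatibleSystems Γ(X, U) Γ(F, U) := by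
  refine solvesCompatibleSystems_of_forall_isMaximal fun m n c a hca P hP ↦ ?_
  obtain ⟨x, hx⟩ : ∃ x : U, hU.primeIdealOf x = ⟨P, hP.isPrime⟩ :=
    hU.isoSpec.hom.homeomorph.surjective _
  have := hU.isLocalization_stalk x
  have := F.isLocalizedModule_germLinearMap hU x
  obtain ⟨r, hr, y, hy⟩ := (h x).exists_smul_solution (hU.primeIdealOf x).asIdeal.primeCompl
    (F.germLinearMap x) c a hca
  exact ⟨r, fun hrP ↦ hr (by rw [hx]; exact hrP), y, hy⟩

end Scheme.Modules

end AlgebraicGeometry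

theorem mainTheorem8 (X : Scheme.{u}) (hX : IsLocallyCoherent X)
    (F : X.Modules) (hF : F.IsQuasicoherent) :
    List.TFAE
      [∀ U : X.Opens, IsAffineOpen U → IsAbsolutelyPure Γ(X, U) Γ(F, U),
       ∃ (ι : Type u) (U : ι → X.Opens), IsOpenCover U ∧ (∀ i, IsAffineOpen (U i)) ∧
         ∀ i, IsAbsolutelyPure Γ(X, U i) Γ(F, U i),
       ∀ x : X, IsAbsolutelyPure (X.presheaf.stalk x) (F.presheaf.stalk x)] := by
  simp only [isAbsolutelyPure_iff_solvesCompatibleSystems]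
  tfae_have 1 → 2 := fun h ↦ ⟨X.affineOpens, (↑), iSup_affineOpens_eq_top X, fun i ↦ i.2,
    fun i ↦ h i i.2⟩
  tfae_have 2 → 3 := fun ⟨ι, U, hcov, hU, h⟩ x ↦ by
    obtain ⟨i, hi⟩ := hcov.exists_mem x
    exact F.solvesCompatibleSystems_stalk (hU i) (hX _ (hU i)) (h i) ⟨x, hi⟩
  tfae_have 3 → 1 := fun h U hU ↦ F.solvesCompatibleSystems_of_stalk hU fun x ↦ h x
  tfae_finish
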